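/- Let $\mathfrak g$ be a finite-dimensional complex semisimple Lie algebra, let $\mathfrak q$ be a parabolic subalgebra of $\mathfrak g$ (a Lie subalgebra containing a Borel, i.e. maximal solvable, subalgebra of $\mathfrak g$), let $\mathfrak q^{n}$ be its nilradical, and let $\sigma$ be an anti-$\mathbb C$-linear involution of $\mathfrak g$ (a conjugate-linear map $\sigma:\mathfrak g\to\mathfrak g$ with $\sigma([X,Y])=[\sigma(X),\sigma(Y)]$ and $\sigma^2=\mathrm{id}$). Here the nilradical of a Lie algebra is its largest nilpotent ideal. Then the following are equivalent: 1. $\mathfrak q+\sigma(\mathfrak q)$ is a Lie subalgebra of $\mathfrak g$; 2. $\mathfrak q+\sigma(\mathfrak q)$ is the normaliser of $\mathfrak q^{n}\cap\sigma(\mathfrak q^{n})$ in $\mathfrak g$; 3. $\mathfrak q+\sigma(\mathfrak q)$ is a Lie subalgebra of $\mathfrak g$ and $\mathfrak q^{n}\cap\sigma(\mathfrak q^{n})$ is its nilradical; 4. $\mathfrak q^{n}\cap\sigma(\mathfrak q^{n})$ is the nilradical of its normaliser in $\mathfrak g$; 5. $\mathfrak q$ is contained in the normaliser of $\mathfrak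 q^{n}\cap\sigma(\mathfrak q^{n})$ in $\mathfrak g$. -/

import Mathlib

/-- The nilradical of a Lie algebra `K`: the sum of all nilpotent ideals of `K`, which for finite
dimensional `K` is the largest nilpotent ideal.  Here an ideal is nilpotent if it is so as a Lie
algebra in its own right. -/
def LieNilradical (R K : Type*) [CommRing R] [LieRing K] [LieAlgebra R K] : LieIdeal R K :=
  sSup {I : LieIdeal R K | LieRing.IsNilpotent I}

namespace LieSubalgebra

/-- The nilradical of a Lie subalgebra `q` of `L`, as a Lie subalgebra of `L`. -/
def nilradical {R L : Type*} [CommRing R] [LieRing L] [LieAlgebra R L]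
    (q : LieSubalgebra R L) : LieSubalgebra R L :=
  (LieIdeal.toLieSubalgebra R q (LieNilradical R q)).map q.incl

/-- A Borel subalgebra is a maximal solvable subalgebra. -/
def IsBorel {R L : Type*} [CommRing R] [LieRing L] [LieAlgebra R L]
    (b : LieSubalgebra R L) : Prop :=
  Maximal (fun s : LieSubalgebra R L => LieAlgebra.IsSolvable s) b

/-- A subalgebra is parabolic if it contains a Borel subalgebra. -/
def IsParabolic {R L : Type*} [CommRing R] [LieRing L] [LieAlgebra R L]
    (q : LieSubalgebra R L) : Prop :=
  ∃ b : LieSubalgebra R L, b.IsBorel ∧ b ≤ q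

end LieSubalgebra

/-- An anti-`ℂ`-linear involution of a complex Lie algebra: a conjugate-linear map which preserves
brackets and squares to the identity. -/
structure LieAntiInvolution (L : Type*) [LieRing L] [LieAlgebra ℂ L]
    extends L →ₛₗ[starRingEnd ℂ] L where
  map_lie' : ∀ x y : L, toFun ⁅x, y⁆ = ⁅toFun x, toFun y⁆
  involutive' : ∀ x : L, toFun (toFun x) = x

/-- The image `σ(q)` of a complex Lie subalgebra `q` under an anti-linear involution `σ`. -/
def LieAntiInvolution.map {L : Type*} [LieRing L] [LieAlgebra ℂ L] (σ : LieAntiInvolution L)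
    (q : LieSubalgebra ℂ L) : LieSubalgebra ℂ L :=
  { q.toSubmodule.map σ.toLinearMap with
    lie_mem' := by
      rintro _ _ ⟨x, hx, rfl⟩ ⟨y, hy, rfl⟩
      exact ⟨⁅x, y⁆, q.lie_mem hx hy, σ.map_lie' x y⟩ }

/-! Write V = q + σ(q), m = qⁿ ∩ σ(qⁿ), N(m) for the normaliser of m, and ⊥ for Killing orthogonals.

A parabolic has nilradical q^⊥. Since σ conjugates the Killing form, m = V^⊥ and V = m^⊥. As m
consists of ad-nilpotent elements, it is orthogonal to N(m), so N(m) ⊆ V always. If V is a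
subalgebra it is parabolic, with nilradical V^⊥ = m; hence q ⊆ V normalises m. If q normalises m, so
does σ(q), because σ(m) = m, and V = N(m).

Suppose finally that m is the nilradical of N(m). If N(m)^⊥ were not inside m, Engel's theorem would
give an element of N(m) ∩ N(m)^⊥ outside m. But this intersection is an ideal of N(m) made of
ad-nilpotent elements, so it lies in the nilradical m. Thus N(m)^⊥ ⊆ m, and V = m^⊥ ⊆ N(m).

No root decomposition is needed. Ad-nilpotency comes from `exists_conj_semisimple_part`: a companion
y of x, with conjugated eigenvalues, makes the Killing pairing of x and y a sum of squared moduli.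
The inclusion b^⊥ ⊆ b for a Borel b comes from the theorems of Lie and Cartan. -/

/-! ### Nilpotent actions and trace forms -/

namespace LieModule

/-- If a Lie ideal `I` of `K` acts nilpotently on `M`, then `I` lies in the kernel of the trace
form of `M`. -/
theorem traceForm_apply_eq_zero_of_isNilpotent_lieIdeal {R K M : Type*} [CommRing R] [IsReduced R]
    [LieRing K] [LieAlgebra R K] [AddCommGroup M] [Module R M] [LieRingModule K M]
    [LieModule R K M] (I : LieIdeal R K) [hI : LieModule.IsNilpotent I M] {x : K} (hx : x ∈ I)
    (y : K) : traceForm R K M x y = 0 := by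
  obtain ⟨k, hk⟩ := (LieModule.isNilpotent_iff R I M).mp hI
  -- The terms of the series are `K`-stable, so `y` preserves the depth that each `x` gains.
  have key : ∀ n (m : M), ((toEnd R K M x * toEnd R K M y) ^ n) m ∈ I.lcs M n := by
    intro n
    induction n with
    | zero => simp
    | succ n ih =>
      intro m
      rw [pow_succ', Module.End.mul_apply, LieIdeal.lcs_succ]
      exact LieSubmodule.lie_mem_lie hx (LieSubmodule.lie_mem _ (ih m))
  have hnil : _root_.IsNilpotent (toEnd R K M x * toEnd R K M y) := by
    refine ⟨k, LinearMap.ext fun m ↦ ?_⟩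
    have h := key k m
    rw [← LieSubmodule.mem_toSubmodule, LieIdeal.coe_lcs_eq, hk] at h
    simpa using h
  exact (LinearMap.isNilpotent_trace_of_isNilpotent hnil).eq_zero

/-- The derived ideal of a solvable Lie algebra acts nilpotently on every finite-dimensional
module. -/
theorem isNilpotent_derivedSeries_of_isSolvable {k K V : Type*} [Field k] [CharZero k]
    [IsAlgClosed k] [LieRing K] [LieAlgebra k K] [LieAlgebra.IsSolvable K] [AddCommGroup V]
    [Module k V] [LieRingModule K V] [LieModule k K V] [FiniteDimensional k V] :
    LieModule.IsNilpotent (LieAlgebra.derivedSeries k K 1) V := by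
  set I := LieAlgebra.derivedSeries k K 1
  have hanti : Antitone (I.lcs V) := antitone_nat_of_succ_le fun n ↦ by
    rw [LieIdeal.lcs_succ]
    exact LieSubmodule.lie_le_right _ _
  have hlt : WellFoundedLT (LieSubmodule k K V) :=
    LieSubmodule.wellFoundedLT_of_isArtinian k K V
  have hwf : WellFoundedGT (LieSubmodule k K V)ᵒᵈ := inferInstance
  obtain ⟨n, hn⟩ := hwf.monotone_chain_condition ⟨fun n ↦ OrderDual.toDual (I.lcs V n), hanti⟩
  set W : LieSubmodule k K V := I.lcs V n
  have hW : W = ⁅I, W⁆ := by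
    rw [← LieIdeal.lcs_succ]
    exact hn (n + 1) n.le_succ
  rw [isNilpotent_iff k]
  refine ⟨n, ?_⟩
  rw [← LieSubmodule.toSubmodule_eq_bot, ← LieIdeal.coe_lcs_eq, LieSubmodule.toSubmodule_eq_bot]
  by_contra hne
  have : Nontrivial W := (LieSubmodule.nontrivial_iff_ne_bot k K V).mpr hne
  -- Lie's theorem on the dual of the stable term W = ⁅I, W⁆: the weight kills brackets, so the
  -- eigenfunctional φ vanishes on ⁅I, W⁆ = W.
  obtain ⟨χ, hχ⟩ := exists_nontrivial_weightSpace_of_isSolvable k K (Module.Dual k W)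
  obtain ⟨⟨φ, hφ⟩, hφ0⟩ := exists_ne (0 : weightSpace (Module.Dual k W) χ)
  rw [mem_weightSpace] at hφ
  have hφ0 : φ ≠ 0 := fun h ↦ hφ0 (Subtype.ext h)
  have hχI : ∀ u ∈ I, χ u = 0 := by
    intro u hu
    rw [show I = LieAlgebra.derivedSeries k K 1 from rfl, LieAlgebra.derivedSeries_def, LieAlgebra.derivedSeriesOfIdeal_succ,
      LieAlgebra.derivedSeriesOfIdeal_zero, ← LieSubmodule.mem_toSubmodule,
      LieSubmodule.lieIdeal_oper_eq_linear_span'] at hu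
    induction hu using Submodule.span_induction with
    | mem u hu =>
      obtain ⟨y, -, z, -, rfl⟩ := hu
      have h := hφ ⁅y, z⁆
      rw [lie_lie, hφ z, lie_smul, hφ y, lie_smul, hφ z, smul_comm, sub_self] at h
      exact (smul_eq_zero.mp h.symm).resolve_right hφ0
    | zero => simp
    | add u v _ _ hu hv => rw [map_add, hu, hv, add_zero]
    | smul c u _ hu => rw [map_smul, hu, smul_zero]
  have hle : W.toSubmodule ≤ (LinearMap.ker φ).map W.toSubmodule.subtype := by
    conv_lhs => rw [hW, LieSubmodule.lieIdeal_oper_eq_linear_span']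
    rw [Submodule.span_le]
    rintro _ ⟨x, hx, w, hw, rfl⟩
    have h := LinearMap.congr_fun (hφ x) ⟨w, hw⟩
    rw [hχI x hx, zero_smul, Module.Dual.lie_apply, LinearMap.zero_apply, neg_eq_zero] at h
    exact ⟨_, h, rfl⟩
  refine hφ0 (LinearMap.ext fun w ↦ ?_)
  obtain ⟨w', hw', h⟩ := hle w.2
  obtain rfl : w' = w := Subtype.ext h
  exact hw'

end LieModule

/-! ### Cartan's criterion -/

namespace LieSubalgebra

/-- **Cartan's criterion** for a Lie subalgebra, with respect to the Killing form of the ambient Lie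
algebra. -/
theorem isSolvable_of_killingForm_apply_lie_eq_zero {R L : Type*} [Field R] [CharZero R]
    [LieRing L] [LieAlgebra R L] [FiniteDimensional R L] (K : LieSubalgebra R L)
    (h : ∀ x ∈ K, ∀ y ∈ K, ∀ z ∈ K, killingForm R L x ⁅y, z⁆ = 0) : LieAlgebra.IsSolvable K := by
  set D : LieIdeal R K := ⁅(⊤ : LieIdeal R K), (⊤ : LieIdeal R K)⁆
  set DD : LieIdeal R K := ⁅D, D⁆
  have hD : ∀ x ∈ K, ∀ u ∈ D, killingForm R L x u = 0 := by
    intro x hx u hu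
    rw [← LieSubmodule.mem_toSubmodule, LieSubmodule.lieIdeal_oper_eq_linear_span'] at hu
    induction hu using Submodule.span_induction with
    | mem u hu =>
      obtain ⟨y, -, z, -, rfl⟩ := hu
      exact h x hx y y.2 z z.2
    | zero => simp
    | add u v _ _ hu hv => simp [hu, hv]
    | smul c u _ hu => simp [hu]
  -- The form need not vanish on all of `K`, only on `D`; passing to `D` and then to `DD` accounts
  -- for the later `k + 2`.
  have tf : LieModule.traceForm R D L = 0 := by
    ext ⟨x, hx⟩ ⟨y, hy⟩
    exact hD x x.2 y hy
  have hnil : LieModule.IsNilpotent (LieAlgebra.derivedSeries R D 1) L :=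
    LieModule.isNilpotent_derivedSeries_of_traceForm_eq_zero tf
  have hDD : LieRing.IsNilpotent DD := by
    rw [LieAlgebra.isNilpotent_iff_forall (R := R)]
    rintro ⟨x, hx⟩
    apply LieSubalgebra.isNilpotent_ad_of_isNilpotent_ad (DD : LieSubalgebra R K) (x := ⟨x, hx⟩)
    apply LieSubalgebra.isNilpotent_ad_of_isNilpotent_ad K
    refine (LieModule.isNilpotent_iff_forall' (R := R)).mp hnil
      ⟨⟨x, LieSubmodule.lie_le_left D D hx⟩, ?_⟩
    rwa [LieIdeal.derivedSeries_eq_derivedSeriesOfIdeal_comap, LieIdeal.mem_comap]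
  obtain ⟨k, hk⟩ := LieAlgebra.IsSolvable.solvable R DD
  rw [LieIdeal.derivedSeries_eq_bot_iff] at hk
  refine LieAlgebra.IsSolvable.mk (R := R) (k := k + 2) ?_
  rw [LieAlgebra.derivedSeries_def, LieAlgebra.derivedSeriesOfIdeal_add,
    LieAlgebra.derivedSeriesOfIdeal_succ, LieAlgebra.derivedSeriesOfIdeal_succ,
    LieAlgebra.derivedSeriesOfIdeal_zero]
  exact hk

end LieSubalgebra

/-! ### The conjugate semisimple part of an element -/

namespace LieAlgebra

open Module.End

/-- Every element `x` of a semisimple complex Lie algebra has a companion `y` stabilising each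
`ad x`-stable subspace and detecting ad-nilpotency of `x`: it acts on each generalised eigenspace of
`ad x` by the conjugate of the eigenvalue. -/
theorem exists_conj_semisimple_part {L : Type*} [LieRing L] [LieAlgebra ℂ L] [FiniteDimensional ℂ L]
    [IsKilling ℂ L] (x : L) :
    ∃ y : L, (∀ W : Submodule ℂ L, (∀ w ∈ W, ⁅x, w⁆ ∈ W) → ∀ w ∈ W, ⁅y, w⁆ ∈ W) ∧
      (killingForm ℂ L x y = 0 → IsNilpotent (ad ℂ L x)) := by
  classical
  set E : ℂ → Submodule ℂ L := (ad ℂ L x).maxGenEigenspace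
  have htop : ⨆ μ, E μ = ⊤ := iSup_maxGenEigenspace_eq_top _
  have hind : iSupIndep E := independent_maxGenEigenspace _
  have hint : DirectSum.IsInternal E :=
    DirectSum.isInternal_submodule_of_iSupIndep_of_iSup_eq_top hind htop
  let v := hint.collectedBasis fun μ ↦ Module.finBasis ℂ (E μ)
  let D : L →ₗ[ℂ] L := v.constr ℂ fun i ↦ (starRingEnd ℂ i.1) • v i
  have hDE : ∀ μ, ∀ z ∈ E μ, D z = (starRingEnd ℂ μ) • z := by
    intro μ z hz
    have : D ∘ₗ (E μ).subtype = (starRingEnd ℂ μ) • (E μ).subtype := by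
      refine (Module.finBasis ℂ (E μ)).ext fun j ↦ ?_
      have h : v ⟨μ, j⟩ = (Module.finBasis ℂ (E μ) j : L) := by
        simp [v, DirectSum.IsInternal.collectedBasis_coe]
      simp only [LinearMap.comp_apply, Submodule.subtype_apply, LinearMap.smul_apply, ← h, D,
        Module.Basis.constr_basis]
    exact LinearMap.congr_fun this ⟨z, hz⟩
  have hEE : ∀ μ ν, ∀ a ∈ E μ, ∀ b ∈ E ν, ⁅a, b⁆ ∈ E (μ + ν) := fun μ ν a ha b hb ↦
    LieModule.lie_mem_maxGenEigenspace_toEnd (R := ℂ) (L := L) (M := L) ha hb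
  -- Conjugation is additive and eigenvalues add under brackets, so `D` is a derivation, hence
  -- inner.
  have hder : ∀ a b, D ⁅a, b⁆ = ⁅a, D b⁆ - ⁅b, D a⁆ := by
    intro a b
    have ha : a ∈ ⨆ μ, E μ := htop ▸ Submodule.mem_top
    have hb : b ∈ ⨆ μ, E μ := htop ▸ Submodule.mem_top
    induction ha using Submodule.iSup_induction' with
    | zero => simp
    | add a a' _ _ h h' => simp only [add_lie, map_add, lie_add, h, h']; abel
    | mem μ a ha =>
      induction hb using Submodule.iSup_induction' with
      | zero => simp
      | add b b' _ _ h h' => simp only [add_lie, map_add, lie_add, h, h']; abel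
      | mem ν b hb =>
        rw [hDE _ _ (hEE _ _ _ ha _ hb), hDE _ _ ha, hDE _ _ hb, map_add, add_smul, lie_smul,
          lie_smul, ← lie_skew a b, smul_neg, smul_neg]
        abel
  obtain ⟨y, hy⟩ := LieDerivation.IsKilling.exists_eq_ad (R := ℂ) (L := L)
    { toLinearMap := D, leibniz' := hder }
  have hyD : ∀ z, ⁅y, z⁆ = D z := fun z ↦ by
    simpa using! LieDerivation.congr_fun hy z
  refine ⟨y, fun W hW w hw ↦ ?_, fun hxy ↦ ?_⟩
  · rw [hyD]
    -- A stable subspace is the sum of its intersections with the `E μ`, on each of which `D` is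
    -- scalar.
    rw [Submodule.eq_iSup_inf_genEigenspace (f := ad ℂ L x) ⊤ hW htop] at hw
    induction hw using Submodule.iSup_induction' with
    | zero => simp
    | add a b _ _ h h' => rw [map_add]; exact add_mem h h'
    | mem μ a ha => rw [hDE μ a ha.2]; exact W.smul_mem _ ha.1
  · have hfin : {μ | E μ ≠ ⊥}.Finite := WellFoundedGT.finite_ne_bot_of_iSupIndep hind
    have hxE : ∀ μ, Set.MapsTo (ad ℂ L x) (E μ) (E μ) := fun μ ↦
      mapsTo_maxGenEigenspace_of_comm (Commute.refl _) μ
    have hyE : ∀ μ, Set.MapsTo (ad ℂ L y) (E μ) (E μ) := fun μ z hz ↦ by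
      rw [SetLike.mem_coe, ad_apply, hyD, hDE μ z hz]
      exact (E μ).smul_mem _ hz
    have hxyE : ∀ μ, Set.MapsTo (ad ℂ L x ∘ₗ ad ℂ L y) (E μ) (E μ) := fun μ z hz ↦
      hxE μ (hyE μ hz)
    -- The contribution of `E μ` is dim(E μ)·|μ|²; a vanishing sum of these leaves only the
    -- eigenvalue 0.
    have htr : ∀ μ, LinearMap.trace ℂ (E μ)
        ((ad ℂ L x ∘ₗ ad ℂ L y).restrict (hxyE μ)) =
        ((Module.finrank ℂ (E μ) * Complex.normSq μ : ℝ) : ℂ) := by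
      intro μ
      have h1 : (ad ℂ L x ∘ₗ ad ℂ L y).restrict (hxyE μ) =
          (starRingEnd ℂ μ) • (ad ℂ L x).restrict (hxE μ) := by
        ext ⟨z, hz⟩
        have : ⁅x, ⁅y, z⁆⁆ = (starRingEnd ℂ μ) • ⁅x, z⁆ := by rw [hyD, hDE μ z hz, lie_smul]
        simpa using! this
      have h2 : LinearMap.trace ℂ (E μ) ((ad ℂ L x).restrict (hxE μ)) =
          μ * Module.finrank ℂ (E μ) := by
        have h := (LinearMap.isNilpotent_trace_of_isNilpotent
          (isNilpotent_restrict_maxGenEigenspace_sub_algebraMap (ad ℂ L x) μ)).eq_zero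
        have h3 : (ad ℂ L x).restrict (hxE μ) = LinearMap.restrict _
            (mapsTo_maxGenEigenspace_of_comm (Algebra.mul_sub_algebraMap_commutes (ad ℂ L x) μ) μ)
            + μ • LinearMap.id := by
          ext ⟨z, hz⟩
          change ⁅x, z⁆ = ⁅x, z⁆ - μ • z + μ • z
          rw [sub_add_cancel]
        rw [h3, map_add, h]
        simp
      rw [h1, map_smul, h2, smul_eq_mul, ← mul_assoc, mul_comm _ μ, Complex.mul_conj, mul_comm]
      push_cast
      rfl
    rw [killingForm_apply_apply, LinearMap.trace_eq_sum_trace_restrict' hint hfin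
      hxyE, Finset.sum_congr rfl fun μ _ ↦ htr μ, ← Complex.ofReal_sum,
      Complex.ofReal_eq_zero, Finset.sum_eq_zero_iff_of_nonneg
        fun μ _ ↦ mul_nonneg (Nat.cast_nonneg _) (Complex.normSq_nonneg _)] at hxy
    have h0 : ∀ μ, μ ≠ 0 → E μ = ⊥ := by
      intro μ hμ
      by_contra h
      have := hxy μ (by simpa using h)
      rcases mul_eq_zero.mp this with h' | h'
      · exact h (Submodule.finrank_eq_zero.mp (by exact_mod_cast h'))
      · exact hμ (Complex.normSq_eq_zero.mp h')
    have hE0 : E 0 = ⊤ := by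
      rw [eq_top_iff, ← htop]
      refine iSup_le fun μ ↦ ?_
      rcases eq_or_ne μ 0 with rfl | hμ
      · exact le_rfl
      · simp [h0 μ hμ]
    rw [Module.End.isNilpotent_iff_of_finite]
    intro z
    have hz : z ∈ E 0 := hE0 ▸ Submodule.mem_top
    simpa [E, mem_maxGenEigenspace] using hz

end LieAlgebra

/-! ### Nilradicals, Killing orthogonals and normalisers -/

namespace LieSubalgebra

theorem mem_nilradical_iff {R L : Type*} [CommRing R] [LieRing L] [LieAlgebra R L]
    {q : LieSubalgebra R L} {x : L} :
    x ∈ q.nilradical ↔ ∃ h : x ∈ q, (⟨x, h⟩ : q) ∈ LieNilradical R q := by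
  constructor
  · rintro ⟨y, hy, rfl⟩
    exact ⟨y.2, hy⟩
  · rintro ⟨h, hx⟩
    exact ⟨⟨x, h⟩, hx, rfl⟩

theorem lie_mem_nilradical {R L : Type*} [CommRing R] [LieRing L] [LieAlgebra R L]
    {q : LieSubalgebra R L} {x y : L} (hx : x ∈ q) (hy : y ∈ q.nilradical) :
    ⁅x, y⁆ ∈ q.nilradical := by
  obtain ⟨hyq, hy⟩ := mem_nilradical_iff.mp hy
  exact mem_nilradical_iff.mpr ⟨q.lie_mem hx hyq, LieSubmodule.lie_mem _ (x := ⟨x, hx⟩) hy⟩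

section Field

variable {k L : Type*} [Field k] [LieRing L] [LieAlgebra k L]

theorem killingForm_ad_pow_apply (x z w : L) (n : ℕ) :
    killingForm k L ((LieAlgebra.ad k L x ^ n) z) w =
      (-1) ^ n * killingForm k L z ((LieAlgebra.ad k L x ^ n) w) := by
  induction n generalizing z with
  | zero => simp
  | succ n ih =>
    rw [pow_succ, Module.End.mul_apply, ih, ← pow_succ, pow_succ' (LieAlgebra.ad k L x),
      Module.End.mul_apply, LieAlgebra.ad_apply, LieAlgebra.ad_apply,
      LieModule.traceForm_apply_lie_apply', pow_succ]
    ring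

theorem mem_orthogonal_killingForm_iff {p : Submodule k L} {x : L} :
    x ∈ (killingForm k L).orthogonal p ↔ ∀ y ∈ p, killingForm k L x y = 0 := by
  rw [LinearMap.BilinForm.mem_orthogonal_iff]
  refine forall₂_congr fun y _ ↦ ?_
  rw [LieModule.traceForm_comm]

theorem lie_mem_orthogonal_killingForm {p : LieSubalgebra k L} {x z : L} (hx : x ∈ p)
    (hz : z ∈ (killingForm k L).orthogonal p.toSubmodule) :
    ⁅x, z⁆ ∈ (killingForm k L).orthogonal p.toSubmodule := by
  rw [mem_orthogonal_killingForm_iff] at hz ⊢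
  intro y hy
  rw [LieModule.traceForm_apply_lie_apply', hz _ (p.lie_mem hx hy), neg_zero]

/-- The ideal of `p` of elements orthogonal to `p` for the Killing form of the ambient algebra. -/
noncomputable def orthogonalIdeal (p : LieSubalgebra k L) : LieIdeal k p where
  __ := ((killingForm k L).orthogonal p.toSubmodule).comap p.toSubmodule.subtype
  lie_mem := fun {x _} hm ↦ lie_mem_orthogonal_killingForm x.2 hm

theorem mem_orthogonalIdeal_iff {p : LieSubalgebra k L} {x : p} :
    x ∈ p.orthogonalIdeal ↔ (x : L) ∈ (killingForm k L).orthogonal p.toSubmodule :=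
  Iff.rfl

variable [FiniteDimensional k L]

/-- **Engel's theorem** for a Lie subalgebra consisting of ad-nilpotent elements. -/
theorem isNilpotent_lieModule_of_forall_isNilpotent_ad (m : LieSubalgebra k L)
    (h : ∀ x ∈ m, IsNilpotent (LieAlgebra.ad k L x)) : LieModule.IsNilpotent m L :=
  (LieModule.isNilpotent_iff_forall' (R := k)).mpr fun x ↦ h x x.2

theorem killingForm_apply_eq_zero_of_isNilpotent_ad {p : LieSubalgebra k L} (I : LieIdeal k p)
    (hI : ∀ x ∈ I, IsNilpotent (LieAlgebra.ad k L x)) {x : p} (hx : x ∈ I) {y : L} (hy : y ∈ p) :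
    killingForm k L x y = 0 := by
  have : LieModule.IsNilpotent I L :=
    (LieModule.isNilpotent_iff_forall' (R := k)).mpr fun x ↦ hI x x.2
  exact LieModule.traceForm_apply_eq_zero_of_isNilpotent_lieIdeal (M := L) I hx ⟨y, hy⟩

theorem mem_nilradical_of_isNilpotent_ad {p : LieSubalgebra k L} (I : LieIdeal k p)
    (hI : ∀ x ∈ I, IsNilpotent (LieAlgebra.ad k L x)) {x : p} (hx : x ∈ I) :
    (x : L) ∈ p.nilradical := by
  have hnil : LieRing.IsNilpotent I := by
    rw [LieAlgebra.isNilpotent_iff_forall (R := k)]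
    rintro ⟨x, hx⟩
    apply isNilpotent_ad_of_isNilpotent_ad (I : LieSubalgebra k p) (x := ⟨x, hx⟩)
    exact isNilpotent_ad_of_isNilpotent_ad p (hI x hx)
  exact mem_nilradical_iff.mpr ⟨x.2, le_sSup (α := LieIdeal k p) hnil hx⟩

theorem orthogonal_killingForm_orthogonal [LieAlgebra.IsKilling k L] (p : Submodule k L) :
    (killingForm k L).orthogonal ((killingForm k L).orthogonal p) = p :=
  LinearMap.BilinForm.orthogonal_orthogonal (LieAlgebra.IsKilling.killingForm_nondegenerate k L)
    (LieModule.traceForm_isSymm k L L).isRefl p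

/-- The normaliser of a subalgebra of ad-nilpotent elements is orthogonal to it. -/
theorem normalizer_le_orthogonal {m : LieSubalgebra k L}
    (hm : ∀ x ∈ m, IsNilpotent (LieAlgebra.ad k L x)) :
    m.normalizer.toSubmodule ≤ (killingForm k L).orthogonal m.toSubmodule := by
  obtain ⟨I, hI⟩ := exists_nested_lieIdeal_ofLe_normalizer m.le_normalizer le_rfl
  have hmem : ∀ x : m.normalizer, x ∈ I ↔ (x : L) ∈ m := fun x ↦ by
    rw [← LieIdeal.mem_toLieSubalgebra, hI, mem_ofLe]
  intro y hy
  rw [mem_orthogonal_killingForm_iff]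
  intro x hx
  rw [LieModule.traceForm_comm]
  exact killingForm_apply_eq_zero_of_isNilpotent_ad I (fun x hx ↦ hm x ((hmem x).mp hx))
    (x := ⟨x, m.le_normalizer hx⟩) ((hmem _).mpr hx) hy

/-- If `q` contains its Killing orthogonal, which consists of ad-nilpotent elements, then the
latter is the nilradical of `q`. -/
theorem nilradical_toSubmodule_eq_orthogonal [LieAlgebra.IsKilling k L] {q : LieSubalgebra k L}
    (h₁ : (killingForm k L).orthogonal q.toSubmodule ≤ q.toSubmodule)
    (h₂ : ∀ x ∈ (killingForm k L).orthogonal q.toSubmodule, IsNilpotent (LieAlgebra.ad k L x)) :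
    q.nilradical.toSubmodule = (killingForm k L).orthogonal q.toSubmodule := by
  apply le_antisymm
  · intro x hx
    obtain ⟨hxq, hx⟩ := mem_nilradical_iff.mp hx
    suffices LieNilradical k q ≤ q.orthogonalIdeal from this hx
    refine sSup_le fun I (hI : LieRing.IsNilpotent I) x hx ↦ ?_
    have hIad : ∀ x ∈ I, IsNilpotent (LieAlgebra.ad k L x) := by
      intro x hx
      obtain ⟨N, hN⟩ := (LieAlgebra.isNilpotent_iff_forall (R := k)).mp hI ⟨x, hx⟩
      have hpow : ∀ (n : ℕ) (y : I), (LieAlgebra.ad k L x ^ n) (y : q) =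
          (((LieAlgebra.ad k I ⟨x, hx⟩ ^ n) y : I) : q) := by
        intro n y
        induction n with
        | zero => rfl
        | succ n ih =>
          rw [pow_succ', pow_succ', Module.End.mul_apply, Module.End.mul_apply, ih]
          rfl
      -- The extra application moves `y` from `q` into the ideal `I`.
      have hq : ∀ y ∈ q, (LieAlgebra.ad k L x ^ (N + 1)) y = 0 := by
        intro y hy
        have h := hpow N ⟨⁅x, ⟨y, hy⟩⁆, lie_mem_left k q I x ⟨y, hy⟩ hx⟩
        rw [hN] at h
        rw [pow_succ, Module.End.mul_apply]
        exact h
      -- Since (ad x)^(N+1) kills q ⊇ q^⊥ and ad x is skew-adjoint, it maps L into q^⊥⊥ = q; a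
      -- second round then gives 0.
      refine ⟨(N + 1) + (N + 1), LinearMap.ext fun z ↦ ?_⟩
      rw [pow_add, Module.End.mul_apply]
      apply hq
      rw [← mem_toSubmodule, ← orthogonal_killingForm_orthogonal q.toSubmodule,
        mem_orthogonal_killingForm_iff]
      intro w hw
      rw [killingForm_ad_pow_apply, hq w (h₁ hw)]
      simp
    rw [mem_orthogonalIdeal_iff, mem_orthogonal_killingForm_iff]
    exact fun y hy ↦ killingForm_apply_eq_zero_of_isNilpotent_ad I hIad hx hy
  · intro x hx
    exact mem_nilradical_of_isNilpotent_ad q.orthogonalIdeal (fun x hx ↦ h₂ x hx)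
      (x := ⟨x, h₁ hx⟩) hx

/-- Let `m` be a subalgebra of ad-nilpotent elements, and `P` a subspace stable under the action of
`m` and not contained in `m`. Then `P` meets the normaliser of `m` outside `m`. -/
theorem exists_mem_normalizer_notMem {m : LieSubalgebra k L}
    (hm : ∀ x ∈ m, IsNilpotent (LieAlgebra.ad k L x)) {P : Submodule k L}
    (hP : ∀ x ∈ m, ∀ z ∈ P, ⁅x, z⁆ ∈ P) (h : ¬ P ≤ m.toSubmodule) :
    ∃ x ∈ P, x ∈ m.normalizer ∧ x ∉ m := by
  classical
  have := m.isNilpotent_lieModule_of_forall_isNilpotent_ad hm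
  obtain ⟨n, hn⟩ := (LieModule.isNilpotent_iff k m L).mp this
  -- At the last depth where the intersection escapes `m`, bracketing with `m` goes one step deeper,
  -- hence into `m`.
  have hex : ∃ n, P ⊓ (LieModule.lowerCentralSeries k m L n).toSubmodule ≤ m.toSubmodule :=
    ⟨n, by simp [hn]⟩
  obtain ⟨j, hj⟩ : ∃ j, Nat.find hex = j + 1 := by
    refine Nat.exists_eq_succ_of_ne_zero fun h0 ↦ h ?_
    have := Nat.find_spec hex
    rw [h0] at this
    simpa using this
  have hlt := Nat.find_min hex (m := j) (by omega)
  have hle := Nat.find_spec hex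
  rw [hj] at hle
  obtain ⟨x, ⟨hxP, hxj⟩, hxm⟩ := SetLike.not_le_iff_exists.mp hlt
  refine ⟨x, hxP, (mem_normalizer_iff' m x).mpr fun y hy ↦ hle ⟨hP y hy x hxP, ?_⟩, hxm⟩
  rw [LieModule.lowerCentralSeries_succ]
  exact LieSubmodule.lie_mem_lie (x := (⟨y, hy⟩ : m)) (LieSubmodule.mem_top _) hxj

end Field

end LieSubalgebra

/-! ### Borel and parabolic subalgebras -/

namespace LieSubalgebra

/-- A Lie subalgebra whose brackets lie in a solvable Lie subalgebra is solvable. -/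
theorem isSolvable_of_forall_lie_mem {R L : Type*} [CommRing R] [LieRing L] [LieAlgebra R L]
    {b K : LieSubalgebra R L} [LieAlgebra.IsSolvable b] (h : ∀ x ∈ K, ∀ y ∈ K, ⁅x, y⁆ ∈ b) :
    LieAlgebra.IsSolvable K := by
  set D : LieIdeal R K := LieAlgebra.derivedSeriesOfIdeal R K 1 ⊤
  have hD : ∀ u ∈ D, (u : L) ∈ b := by
    intro u hu
    rw [show D = ⁅(⊤ : LieIdeal R K), (⊤ : LieIdeal R K)⁆ from rfl,
      ← LieSubmodule.mem_toSubmodule, LieSubmodule.lieIdeal_oper_eq_linear_span'] at hu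
    induction hu using Submodule.span_induction with
    | mem u hu =>
      obtain ⟨y, -, z, -, rfl⟩ := hu
      exact h y y.2 z z.2
    | zero => exact b.zero_mem
    | add u v _ _ hu hv => exact b.add_mem hu hv
    | smul c u _ hu => exact b.smul_mem c hu
  let f : D →ₗ⁅R⁆ b :=
    { toFun := fun u ↦ ⟨u.1, hD u.1 u.2⟩
      map_add' := fun _ _ ↦ rfl
      map_smul' := fun _ _ ↦ rfl
      map_lie' := rfl }
  have hf : Function.Injective f := fun u v huv ↦
    Subtype.ext (Subtype.ext (congrArg (fun z : b ↦ (z : L)) huv))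
  have hsol : LieAlgebra.IsSolvable D := hf.lieAlgebra_isSolvable
  obtain ⟨n, hn⟩ := LieAlgebra.IsSolvable.solvable R D
  rw [LieIdeal.derivedSeries_eq_bot_iff] at hn
  refine LieAlgebra.IsSolvable.mk (R := R) (k := n + 1) ?_
  rw [LieAlgebra.derivedSeries_def, LieAlgebra.derivedSeriesOfIdeal_add]
  exact hn

theorem IsBorel.le_of_isSolvable {R L : Type*} [CommRing R] [LieRing L] [LieAlgebra R L]
    {b K : LieSubalgebra R L} (hb : b.IsBorel) (hK : LieAlgebra.IsSolvable K) (h : b ≤ K) :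
    K ≤ b :=
  hb.2 hK h

/-- Adjoining a normalising element `y` to `b` gives a subalgebra all of whose brackets lie in `b`,
as ⁅y, y⁆ = 0. It is solvable, so maximality applies. -/
theorem IsBorel.normalizer_le {R L : Type*} [CommRing R] [LieRing L] [LieAlgebra R L]
    {b : LieSubalgebra R L} (hb : b.IsBorel) : b.normalizer ≤ b := by
  intro y hy
  let K : LieSubalgebra R L :=
    { R ∙ y ⊔ b.toSubmodule with
      lie_mem' := fun hu hv ↦ b.lie_mem_sup_of_mem_normalizer hy hu hv }
  have hyK : y ∈ K := Submodule.mem_sup_left (Submodule.mem_span_singleton_self y)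
  have hbK : b ≤ K := fun z hz ↦ Submodule.mem_sup_right (S := R ∙ y) hz
  have : LieAlgebra.IsSolvable b := hb.1
  have hlie : ∀ u ∈ K, ∀ v ∈ K, ⁅u, v⁆ ∈ b := by
    intro u hu v hv
    obtain ⟨u₁, hu₁, c, hc, rfl⟩ := Submodule.mem_sup.mp hu
    obtain ⟨v₁, hv₁, d, hd, rfl⟩ := Submodule.mem_sup.mp hv
    obtain ⟨s, rfl⟩ := Submodule.mem_span_singleton.mp hu₁
    obtain ⟨t, rfl⟩ := Submodule.mem_span_singleton.mp hv₁
    rw [add_lie, lie_add, lie_add, smul_lie, smul_lie, lie_smul, lie_smul, lie_self, smul_zero,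
      smul_zero, zero_add]
    exact b.add_mem (b.smul_mem _ ((b.mem_normalizer_iff y).mp hy d hd))
      (b.add_mem (b.smul_mem _ ((b.mem_normalizer_iff' y).mp hy c hc)) (b.lie_mem hc hd))
  exact hb.le_of_isSolvable (isSolvable_of_forall_lie_mem hlie) hbK hyK

section Field

variable {k L : Type*} [Field k] [CharZero k] [IsAlgClosed k] [LieRing L] [LieAlgebra k L]
  [FiniteDimensional k L]

/-- The easy direction of **Cartan's criterion**, for a subalgebra and the Killing form of the
ambient Lie algebra. -/
theorem killingForm_lie_apply_eq_zero_of_isSolvable {b : LieSubalgebra k L}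
    [LieAlgebra.IsSolvable b] {x y z : L} (hx : x ∈ b) (hy : y ∈ b) (hz : z ∈ b) :
    killingForm k L ⁅x, y⁆ z = 0 := by
  have := LieModule.isNilpotent_derivedSeries_of_isSolvable (k := k) (K := b) (V := L)
  exact LieModule.traceForm_apply_eq_zero_of_isNilpotent_lieIdeal (M := L)
    (LieAlgebra.derivedSeries k b 1)
    (LieSubmodule.lie_mem_lie (LieSubmodule.mem_top (⟨x, hx⟩ : b))
      (LieSubmodule.mem_top (⟨y, hy⟩ : b))) ⟨z, hz⟩

/-- Otherwise Lie's theorem, applied to the image of b^⊥ in L/b, gives z ∈ b^⊥ outside b that is an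
eigenvector modulo b. Then b + kz is a subalgebra, solvable by Cartan's criterion because z ⊥ b,
against maximality. -/
theorem IsBorel.orthogonal_le {b : LieSubalgebra k L} (hb : b.IsBorel) :
    (killingForm k L).orthogonal b.toSubmodule ≤ b.toSubmodule := by
  by_contra hnle
  obtain ⟨z₀, hz₀, hz₀b⟩ := SetLike.not_le_iff_exists.mp hnle
  have : LieAlgebra.IsSolvable b := hb.1
  let P : LieSubmodule k b L :=
    { (killingForm k L).orthogonal b.toSubmodule with
      lie_mem := fun {x _} hm ↦ lie_mem_orthogonal_killingForm x.2 hm }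
  let Q : LieSubmodule k b (L ⧸ b.toLieSubmodule) :=
    P.map (LieSubmodule.Quotient.mk' b.toLieSubmodule)
  have hQ : Nontrivial Q := by
    refine (LieSubmodule.nontrivial_iff_ne_bot k b _).mpr fun h ↦ hz₀b ?_
    have hz : LieSubmodule.Quotient.mk' b.toLieSubmodule z₀ ∈ Q :=
      (LieSubmodule.mem_map _).mpr ⟨z₀, hz₀, rfl⟩
    rw [h, LieSubmodule.mem_bot] at hz
    exact (LieSubmodule.Quotient.mk_eq_zero (N := b.toLieSubmodule)).mp hz
  obtain ⟨χ, hχ⟩ := LieModule.exists_nontrivial_weightSpace_of_isSolvable k b Q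
  obtain ⟨⟨⟨q, hq⟩, hqχ⟩, hq0⟩ := exists_ne (0 : LieModule.weightSpace Q χ)
  rw [LieModule.mem_weightSpace] at hqχ
  obtain ⟨z, hz : z ∈ (killingForm k L).orthogonal b.toSubmodule, rfl⟩ :=
    (LieSubmodule.mem_map _).mp hq
  have hzb : z ∉ b := fun h ↦ hq0 (Subtype.ext (Subtype.ext
    ((LieSubmodule.Quotient.mk_eq_zero (N := b.toLieSubmodule)).mpr h)))
  have hzχ : ∀ (y : L) (hy : y ∈ b), ⁅y, z⁆ - χ ⟨y, hy⟩ • z ∈ b := by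
    intro y hy
    have h := congrArg Subtype.val (hqχ ⟨y, hy⟩)
    exact (Submodule.Quotient.eq b.toLieSubmodule.toSubmodule).mp h
  have hbz : ∀ y ∈ b, ⁅y, z⁆ ∈ k ∙ z ⊔ b.toSubmodule := fun y hy ↦
    Submodule.mem_sup.mpr ⟨_, Submodule.smul_mem _ (χ ⟨y, hy⟩) (Submodule.mem_span_singleton_self z),
      _, hzχ y hy, add_sub_cancel _ _⟩
  have hlie : ∀ (c d : L) (s t : k), ⁅s • z + c, t • z + d⁆ =
      t • ⁅c, z⁆ - s • ⁅d, z⁆ + ⁅c, d⁆ := by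
    intro c d s t
    rw [add_lie, lie_add, lie_add, smul_lie, smul_lie, lie_smul, lie_smul, lie_self,
      ← lie_skew d z]
    simp only [smul_zero, zero_add, smul_neg]
    abel
  have hmem : ∀ u ∈ k ∙ z ⊔ b.toSubmodule, ∃ s : k, ∃ c ∈ b, u = s • z + c := by
    intro u hu
    obtain ⟨u₁, hu₁, c, hc, rfl⟩ := Submodule.mem_sup.mp hu
    obtain ⟨s, rfl⟩ := Submodule.mem_span_singleton.mp hu₁
    exact ⟨s, c, hc, rfl⟩
  let K : LieSubalgebra k L :=
    { k ∙ z ⊔ b.toSubmodule with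
      lie_mem' := by
        intro u v hu hv
        obtain ⟨s, c, hc, rfl⟩ := hmem u hu
        obtain ⟨t, d, hd, rfl⟩ := hmem v hv
        rw [hlie]
        exact add_mem (sub_mem (Submodule.smul_mem _ _ (hbz c hc))
          (Submodule.smul_mem _ _ (hbz d hd))) (Submodule.mem_sup_right (b.lie_mem hc hd)) }
  have hzK : z ∈ K := Submodule.mem_sup_left (Submodule.mem_span_singleton_self z)
  have hbK : b ≤ K := fun y hy ↦ Submodule.mem_sup_right (S := k ∙ z) hy
  rw [mem_orthogonal_killingForm_iff] at hz
  -- Invariance alone gives this, so no isotropy of `z` is needed.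
  have hzz : ∀ c, killingForm k L z ⁅c, z⁆ = 0 := fun c ↦ by
    rw [← LieModule.traceForm_apply_lie_apply, LieModule.traceForm_apply_lie_apply', lie_self]
    simp
  have hzl : ∀ c ∈ b, ∀ d ∈ b, killingForm k L d ⁅c, z⁆ = 0 := fun c hc d hd ↦ by
    rw [LieModule.traceForm_comm, LieModule.traceForm_apply_lie_apply', hz _ (b.lie_mem hc hd),
      neg_zero]
  have hK : LieAlgebra.IsSolvable K := by
    refine isSolvable_of_killingForm_apply_lie_eq_zero K fun w hw u hu v hv ↦ ?_
    obtain ⟨r, e, he, rfl⟩ := hmem w hw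
    obtain ⟨s, c, hc, rfl⟩ := hmem u hu
    obtain ⟨t, d, hd, rfl⟩ := hmem v hv
    have h₁ : killingForm k L e ⁅c, d⁆ = 0 := by
      rw [LieModule.traceForm_comm]
      exact killingForm_lie_apply_eq_zero_of_isSolvable hc hd he
    simp [hlie, hzz, hzl c hc e he, hzl d hd e he, h₁, hz _ (b.lie_mem hc hd)]
  exact hzb (hb.le_of_isSolvable hK hbK hzK)

theorem IsParabolic.orthogonal_le {q : LieSubalgebra k L} (hq : q.IsParabolic) :
    (killingForm k L).orthogonal q.toSubmodule ≤ q.toSubmodule := by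
  obtain ⟨b, hb, hbq⟩ := hq
  exact (LinearMap.BilinForm.orthogonal_le hbq).trans (hb.orthogonal_le.trans hbq)

end Field

/-! ### Ad-nilpotency and nilradicals of complex parabolics -/

section Complex

variable {L : Type*} [LieRing L] [LieAlgebra ℂ L] [FiniteDimensional ℂ L]
  [LieAlgebra.IsSemisimple ℂ L] {q : LieSubalgebra ℂ L}

/-- An element normalising `m` and orthogonal to a subalgebra containing the normaliser of `m` is
ad-nilpotent. -/
theorem isNilpotent_ad_of_mem_orthogonal {p m : LieSubalgebra ℂ L} (hmp : m.normalizer ≤ p) {x : L}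
    (hxm : x ∈ m.normalizer) (hx : x ∈ (killingForm ℂ L).orthogonal p.toSubmodule) :
    IsNilpotent (LieAlgebra.ad ℂ L x) := by
  obtain ⟨y, hy, hnil⟩ := LieAlgebra.exists_conj_semisimple_part x
  -- As `ad x` stabilises `m`, so does `ad y`; thus `y` lies in `p`, to which `x` is orthogonal.
  refine hnil (mem_orthogonal_killingForm_iff.mp hx y (hmp ?_))
  exact (m.mem_normalizer_iff y).mpr (hy m.toSubmodule ((m.mem_normalizer_iff x).mp hxm))

/-- For a Borel b ⊆ q one has q^⊥ ⊆ b^⊥ ⊆ b, and b is its own normaliser; so the previous lemma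
applies with p = m = b. -/
theorem IsParabolic.isNilpotent_ad_of_mem_orthogonal (hq : q.IsParabolic) {x : L}
    (hx : x ∈ (killingForm ℂ L).orthogonal q.toSubmodule) : IsNilpotent (LieAlgebra.ad ℂ L x) := by
  obtain ⟨b, hb, hbq⟩ := hq
  have hxb := LinearMap.BilinForm.orthogonal_le (B := killingForm ℂ L)
    (N := b.toSubmodule) (L := q.toSubmodule) hbq hx
  exact LieSubalgebra.isNilpotent_ad_of_mem_orthogonal hb.normalizer_le
    (b.le_normalizer (hb.orthogonal_le hxb)) hxb

/-- The nilradical of a parabolic subalgebra is its Killing orthogonal. -/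
theorem IsParabolic.nilradical_eq_orthogonal (hq : q.IsParabolic) :
    q.nilradical.toSubmodule = (killingForm ℂ L).orthogonal q.toSubmodule :=
  nilradical_toSubmodule_eq_orthogonal hq.orthogonal_le fun _ ↦ hq.isNilpotent_ad_of_mem_orthogonal

/-- A subalgebra of ad-nilpotent elements which is the nilradical of its normaliser has a Killing
orthogonal contained in that normaliser. -/
theorem orthogonal_le_normalizer_of_eq_nilradical {m : LieSubalgebra ℂ L}
    (hm : ∀ x ∈ m, IsNilpotent (LieAlgebra.ad ℂ L x)) (h : m = m.normalizer.nilradical) :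
    (killingForm ℂ L).orthogonal m.toSubmodule ≤ m.normalizer.toSubmodule := by
  have hle : (killingForm ℂ L).orthogonal m.normalizer.toSubmodule ≤ m.toSubmodule := by
    by_contra hnle
    obtain ⟨x, hx, hxn, hxm⟩ := exists_mem_normalizer_notMem hm
      (fun x hx z hz ↦ lie_mem_orthogonal_killingForm (m.le_normalizer hx) hz) hnle
    refine hxm (h ▸ ?_)
    exact mem_nilradical_of_isNilpotent_ad m.normalizer.orthogonalIdeal
      (fun y hy ↦ isNilpotent_ad_of_mem_orthogonal le_rfl y.2 hy) (x := ⟨x, hxn⟩) hx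
  rw [← orthogonal_killingForm_orthogonal m.normalizer.toSubmodule]
  exact LinearMap.BilinForm.orthogonal_le hle

end Complex

end LieSubalgebra

/-! ### The Killing form under an anti-linear involution -/

namespace LieAntiInvolution

variable {L : Type*} [LieRing L] [LieAlgebra ℂ L] (σ : LieAntiInvolution L)

theorem mem_map_iff {q : LieSubalgebra ℂ L} {x : L} : x ∈ σ.map q ↔ σ.toLinearMap x ∈ q := by
  constructor
  · rintro ⟨y, hy, rfl⟩
    rwa [show σ.toLinearMap (σ.toLinearMap y) = y from σ.involutive' y]
  · exact fun h ↦ ⟨_, h, σ.involutive' x⟩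

/-- The images under σ of a basis form a basis, in which ad σ(x) ∘ ad σ(y) has the conjugate of the
matrix of ad x ∘ ad y. -/
theorem killingForm_map_map [FiniteDimensional ℂ L] (x y : L) :
    killingForm ℂ L (σ.toLinearMap x) (σ.toLinearMap y) =
      starRingEnd ℂ (killingForm ℂ L x y) := by
  classical
  have hinv : ∀ x, σ.toLinearMap (σ.toLinearMap x) = x := σ.involutive'
  have hlie : ∀ x y, σ.toLinearMap ⁅x, y⁆ = ⁅σ.toLinearMap x, σ.toLinearMap y⁆ := σ.map_lie'
  let v := Module.finBasis ℂ L
  have hv : ∀ z, ∑ i, (starRingEnd ℂ) (v.repr (σ.toLinearMap z) i) • σ.toLinearMap (v i) = z := by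
    intro z
    conv_rhs => rw [← hinv z, ← v.sum_repr (σ.toLinearMap z), map_sum]
    simp only [LinearMap.map_smulₛₗ]
  have hli : LinearIndependent ℂ fun i ↦ σ.toLinearMap (v i) := by
    rw [Fintype.linearIndependent_iff]
    intro g hg i
    have h := congrArg σ.toLinearMap hg
    simp only [map_sum, LinearMap.map_smulₛₗ, hinv, map_zero] at h
    simpa using Fintype.linearIndependent_iff.mp v.linearIndependent _ h i
  let w : Module.Basis _ ℂ L := Module.Basis.mk hli fun z _ ↦ by
    rw [← hv z]
    exact sum_mem fun i _ ↦ Submodule.smul_mem _ _ (Submodule.subset_span ⟨i, rfl⟩)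
  have hw : ∀ i, w i = σ.toLinearMap (v i) := fun i ↦ by simp [w]
  have hrepr : ∀ z i, w.repr z i = (starRingEnd ℂ) (v.repr (σ.toLinearMap z) i) := by
    intro z i
    conv_lhs => rw [← hv z]
    simp [← hw, Finsupp.single_apply]
  rw [killingForm_apply_apply, killingForm_apply_apply,
    LinearMap.trace_eq_matrix_trace ℂ w, LinearMap.trace_eq_matrix_trace ℂ v, Matrix.trace,
    Matrix.trace, map_sum]
  refine Finset.sum_congr rfl fun i _ ↦ ?_
  simp [LinearMap.toMatrix_apply, hrepr, hw, hlie, hinv]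

theorem mem_orthogonal_map_iff [FiniteDimensional ℂ L] {q : LieSubalgebra ℂ L} {x : L} :
    x ∈ (killingForm ℂ L).orthogonal (σ.map q).toSubmodule ↔
      σ.toLinearMap x ∈ (killingForm ℂ L).orthogonal q.toSubmodule := by
  have hinv : ∀ x, σ.toLinearMap (σ.toLinearMap x) = x := σ.involutive'
  rw [LieSubalgebra.mem_orthogonal_killingForm_iff, LieSubalgebra.mem_orthogonal_killingForm_iff]
  constructor
  · intro h y hy
    have := h (σ.toLinearMap y) ⟨y, hy, rfl⟩
    rwa [← hinv x, killingForm_map_map, map_eq_zero] at this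
  · rintro h _ ⟨y, hy, rfl⟩
    have := h y hy
    rwa [← map_eq_zero (starRingEnd ℂ), ← killingForm_map_map, hinv] at this

/-- For parabolic `q`, the intersection `qⁿ ∩ σ(qⁿ)` is the Killing orthogonal of `q + σ(q)`. -/
theorem nilradical_inf_map_eq_orthogonal [FiniteDimensional ℂ L] [LieAlgebra.IsSemisimple ℂ L]
    {q : LieSubalgebra ℂ L} (hq : q.IsParabolic) :
    (q.nilradical ⊓ σ.map q.nilradical).toSubmodule =
      (killingForm ℂ L).orthogonal (q.toSubmodule ⊔ (σ.map q).toSubmodule) := by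
  ext x
  have h₁ : x ∈ q.nilradical ↔ x ∈ (killingForm ℂ L).orthogonal q.toSubmodule := by
    rw [← hq.nilradical_eq_orthogonal, LieSubalgebra.mem_toSubmodule]
  have h₂ : x ∈ σ.map q.nilradical ↔
      x ∈ (killingForm ℂ L).orthogonal (σ.map q).toSubmodule := by
    rw [mem_map_iff, mem_orthogonal_map_iff, ← hq.nilradical_eq_orthogonal,
      LieSubalgebra.mem_toSubmodule]
  rw [LieSubalgebra.mem_toSubmodule, LieSubalgebra.mem_inf, h₁, h₂]
  constructor
  · rintro ⟨h, h'⟩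
    rw [LieSubalgebra.mem_orthogonal_killingForm_iff] at h h' ⊢
    intro y hy
    obtain ⟨a, ha, b, hb, rfl⟩ := Submodule.mem_sup.mp hy
    rw [map_add, h a ha, h' b hb, add_zero]
  · exact fun h ↦ ⟨LinearMap.BilinForm.orthogonal_le le_sup_left h,
      LinearMap.BilinForm.orthogonal_le le_sup_right h⟩

end LieAntiInvolution

/-! ### The equivalences -/

theorem mainTheorem11 {L : Type*} [LieRing L] [LieAlgebra ℂ L] [FiniteDimensional ℂ L]
    [LieAlgebra.IsSemisimple ℂ L] (q : LieSubalgebra ℂ L) (hq : q.IsParabolic)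
    (σ : LieAntiInvolution L) :
    List.TFAE [
      ∃ s : LieSubalgebra ℂ L, s.toSubmodule = q.toSubmodule ⊔ (σ.map q).toSubmodule,
      q.toSubmodule ⊔ (σ.map q).toSubmodule
        = (q.nilradical ⊓ σ.map q.nilradical).normalizer.toSubmodule,
      ∃ s : LieSubalgebra ℂ L, s.toSubmodule = q.toSubmodule ⊔ (σ.map q).toSubmodule ∧
        q.nilradical ⊓ σ.map q.nilradical = s.nilradical,
      q.nilradical ⊓ σ.map q.nilradical
        = (q.nilradical ⊓ σ.map q.nilradical).normalizer.nilradical,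
      q ≤ (q.nilradical ⊓ σ.map q.nilradical).normalizer] := by
  have hm : (q.nilradical ⊓ σ.map q.nilradical).toSubmodule =
      (killingForm ℂ L).orthogonal (q.toSubmodule ⊔ (σ.map q).toSubmodule) :=
    σ.nilradical_inf_map_eq_orthogonal hq
  have hσ : ∀ x ∈ q.nilradical ⊓ σ.map q.nilradical,
      σ.toLinearMap x ∈ q.nilradical ⊓ σ.map q.nilradical := by
    rintro x ⟨h₁, h₂⟩
    exact ⟨σ.mem_map_iff.mp h₂, ⟨x, h₁, rfl⟩⟩
  have hnil : ∀ x ∈ q.nilradical ⊓ σ.map q.nilradical, IsNilpotent (LieAlgebra.ad ℂ L x) := by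
    intro x hx
    apply hq.isNilpotent_ad_of_mem_orthogonal
    rw [← hq.nilradical_eq_orthogonal]
    exact hx.1
  set m := q.nilradical ⊓ σ.map q.nilradical
  set V := q.toSubmodule ⊔ (σ.map q).toSubmodule
  have hV : (killingForm ℂ L).orthogonal m.toSubmodule = V := by
    rw [hm, LieSubalgebra.orthogonal_killingForm_orthogonal]
  have hNV : m.normalizer.toSubmodule ≤ V := hV ▸ LieSubalgebra.normalizer_le_orthogonal hnil
  have hs : ∀ s : LieSubalgebra ℂ L, s.toSubmodule = V → m = s.nilradical := by
    intro s hs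
    have hqs : q ≤ s := by
      rw [← LieSubalgebra.toSubmodule_le_toSubmodule, hs]
      exact le_sup_left
    obtain ⟨b, hb, hbq⟩ := hq
    have hsp : s.IsParabolic := ⟨b, hb, hbq.trans hqs⟩
    rw [← LieSubalgebra.toSubmodule_inj, hm, ← hs, hsp.nilradical_eq_orthogonal]
  tfae_have 1 → 3 := fun ⟨s, h⟩ ↦ ⟨s, h, hs s h⟩
  tfae_have 3 → 5 := by
    rintro ⟨s, h, hms⟩ x hx
    have hxs : x ∈ s := by
      rw [← LieSubalgebra.mem_toSubmodule, h]
      exact Submodule.mem_sup_left hx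
    rw [LieSubalgebra.mem_normalizer_iff, hms]
    exact fun y hy ↦ LieSubalgebra.lie_mem_nilradical hxs hy
  tfae_have 5 → 2 := by
    intro h
    refine le_antisymm (sup_le h ?_) hNV
    rintro _ ⟨x, hx, rfl⟩
    refine (m.mem_normalizer_iff _).mpr fun y hy ↦ ?_
    -- Uses ⁅σx, y⁆ = σ⁅x, σy⁆ and σ(m) ⊆ m.
    have h₁ := hσ _ ((m.mem_normalizer_iff x).mp (h hx) _ (hσ y hy))
    rwa [show σ.toLinearMap ⁅x, σ.toLinearMap y⁆ = _ from σ.map_lie' _ _,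
      show σ.toFun (σ.toLinearMap y) = y from σ.involutive' y] at h₁
  tfae_have 2 → 1 := fun h ↦ ⟨m.normalizer, h.symm⟩
  tfae_have 2 → 4 := fun h ↦ hs _ h.symm
  tfae_have 4 → 5 := by
    intro h
    have := LieSubalgebra.orthogonal_le_normalizer_of_eq_nilradical hnil h
    rw [hV] at this
    exact fun x hx ↦ this (Submodule.mem_sup_left hx)
  tfae_finish
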